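/- Let $\varphi:[0,\infty)\to(0,\infty)$ be a positive $C^\infty$ function (with one-sided derivatives at $0$) that is completely monotone, i.e. $(-1)^k\varphi^{(k)}(x)\ge 0$ for all integers $k\ge 0$ and all $x\ge 0$. Then $\log\varphi$ is convex on $[0,\infty)$. -/

import Mathlib

open scoped ContDiff

/-- `f` is completely monotone on `ℝ₊ = [0, ∞)`: it is `C^∞` there and `(-1)^k f^(k) ≥ 0` on `[0, ∞)`
for all `k ≥ 0`. Derivatives are taken within `[0, ∞)`, so they are one-sided at `0` and the values
of `f` at negative arguments play no role. -/
def CompletelyMonotone (f : ℝ → ℝ) : Prop :=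
  ContDiffOn ℝ ∞ f (Set.Ici 0) ∧
    ∀ k : ℕ, ∀ x ∈ Set.Ici (0 : ℝ), 0 ≤ (-1 : ℝ) ^ k * iteratedDerivWithin k f (Set.Ici 0) x

open Set Filter Topology

/-! With `fₙ = (-1)ⁿ φ⁽ⁿ⁾`, convexity of `log φ` amounts to `f₁² ≤ f₀ f₂`. A bound `d f₂² ≤ f₁ f₃`
makes `(2 - d) f₀ - f₁² / f₂` decreasing; were it ever negative, `f₁` would decay no faster than `1
/ x` and `f₀`, losing a logarithm, would become nonpositive. Since shifted sequences satisfy the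
same hypotheses, the constant improves by `d ↦ 1 / (2 - d)`: from `0` through `k / (k + 1)` to `1`.
-/

/-- One step of the iteration: a bound `d f₂² ≤ f₁ f₃` on the negated derivatives of `f₀` improves to
`f₁² ≤ (2 - d) f₀ f₂`. -/
lemma sq_le_mul_of_mul_sq_le {f₀ f₁ f₂ f₃ : ℝ → ℝ} {d : ℝ}
    (h₀ : ∀ x, 0 < x → HasDerivAt f₀ (-f₁ x) x) (h₁ : ∀ x, 0 < x → HasDerivAt f₁ (-f₂ x) x)
    (h₂ : ∀ x, 0 < x → HasDerivAt f₂ (-f₃ x) x) (p₀ : ∀ x, 0 < x → 0 < f₀ x)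
    (p₁ : ∀ x, 0 < x → 0 < f₁ x) (p₂ : ∀ x, 0 < x → 0 < f₂ x)
    (hd : ∀ x, 0 < x → d * f₂ x ^ 2 ≤ f₁ x * f₃ x) (hd2 : 0 ≤ 2 - d) {a : ℝ} (ha : 0 < a) :
    f₁ a ^ 2 ≤ (2 - d) * (f₀ a * f₂ a) := by
  have anti : ∀ F F' : ℝ → ℝ, (∀ x, a ≤ x → HasDerivAt F (F' x) x) → (∀ x, a ≤ x → F' x ≤ 0) →
      ∀ x, a ≤ x → F x ≤ F a := by
    intro F F' hF hF' x hx
    refine antitoneOn_of_hasDerivWithinAt_nonpos (f' := F') (convex_Ici a)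
      (fun y hy => (hF y hy).continuousAt.continuousWithinAt)
      (fun y hy => (hF y (interior_subset hy)).hasDerivWithinAt)
      (fun y hy => hF' y (interior_subset hy)) self_mem_Ici hx hx
  by_contra! hlt
  set F : ℝ → ℝ := fun x => (2 - d) * f₀ x - f₁ x ^ 2 / f₂ x with hF
  obtain ⟨δ, hδ⟩ : ∃ δ, δ = -F a := ⟨_, rfl⟩
  have hδ0 : 0 < δ := by
    have h := p₂ a ha
    have : (2 - d) * f₀ a < f₁ a ^ 2 / f₂ a := by rw [lt_div_iff₀ h]; linarith
    rw [hδ]; simp only [hF]; linarith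
  have hFa := anti F (fun x => f₁ x * (d - f₁ x * f₃ x / f₂ x ^ 2))
    (fun x hx => by
      have hx0 := ha.trans_le hx
      have hne := (p₂ x hx0).ne'
      refine HasDerivAt.congr_deriv (((h₀ x hx0).const_mul (2 - d)).sub (((h₁ x hx0).pow 2).div (h₂ x hx0) hne)) ?_
      simp only [Pi.pow_apply]
      field_simp
      ring)
    (fun x hx => by
      have hx0 := ha.trans_le hx
      refine mul_nonpos_of_nonneg_of_nonpos (p₁ x hx0).le (sub_nonpos.2 ?_)
      rw [le_div_iff₀ (pow_pos (p₂ x hx0) 2)]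
      exact hd x hx0)
  have hf₂ : ∀ x, a ≤ x → f₂ x / f₁ x ^ 2 ≤ 1 / δ := by
    intro x hx
    have hx0 := ha.trans_le hx
    have q₂ := p₂ x hx0
    have h : δ ≤ f₁ x ^ 2 / f₂ x := by
      have h := hFa x hx
      have : 0 ≤ (2 - d) * f₀ x := mul_nonneg hd2 (p₀ x hx0).le
      rw [← neg_eq_iff_eq_neg.2 hδ] at h
      simp only [hF] at h
      linarith
    rw [le_div_iff₀ q₂] at h
    rw [div_le_div_iff₀ (pow_pos (p₁ x hx0) 2) hδ0]
    linarith
  -- `(1 / f₁)' = f₂ / f₁² ≤ 1 / δ`, so `1 / f₁` grows at most linearly.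
  have hinv := anti (fun x => (f₁ x)⁻¹ - (x - a) / δ) (fun x => f₂ x / f₁ x ^ 2 - 1 / δ)
    (fun x hx => by
      have hx0 := ha.trans_le hx
      refine HasDerivAt.congr_deriv (((h₁ x hx0).inv (p₁ x hx0).ne').sub
        (((hasDerivAt_id x).sub_const a).div_const δ)) ?_
      simp)
    (fun x hx => sub_nonpos.2 (hf₂ x hx))
  simp only [sub_self, zero_div, sub_zero] at hinv
  set A := (f₁ a)⁻¹
  have hA0 : 0 < A := inv_pos.2 (p₁ a ha)
  have hlin : ∀ x, a ≤ x → 0 < A + (x - a) / δ := fun x hx =>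
    add_pos_of_pos_of_nonneg hA0 (div_nonneg (sub_nonneg.2 hx) hδ0.le)
  have hlog := anti (fun x => f₀ x + δ * Real.log (A + (x - a) / δ))
    (fun x => -f₁ x + (A + (x - a) / δ)⁻¹)
    (fun x hx => by
      have hx0 := ha.trans_le hx
      have hne := (hlin x hx).ne'
      refine HasDerivAt.congr_deriv ((h₀ x hx0).add ((((((hasDerivAt_id x).sub_const a).div_const δ).const_add A).log
        hne).const_mul δ)) ?_
      simp only [id]
      field_simp)
    (fun x hx => by
      have h : (A + (x - a) / δ)⁻¹ ≤ f₁ x :=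
        inv_le_of_inv_le₀ (p₁ x (ha.trans_le hx)) (by linarith [hinv x hx])
      linarith)
  simp only [sub_self, zero_div, add_zero] at hlog
  -- `M` is the value of the logarithm at which the bound `hlog` forces `f₀ ≤ 0`.
  set M := f₀ a / δ + Real.log A with hM
  have hAM : A ≤ Real.exp M := by
    rw [← Real.log_le_iff_le_exp hA0]
    linarith [div_pos (p₀ a ha) hδ0]
  have hy : a ≤ a + δ * (Real.exp M - A) := by
    linarith [mul_nonneg hδ0.le (sub_nonneg.2 hAM)]
  have h := hlog _ hy
  have e : A + (a + δ * (Real.exp M - A) - a) / δ = Real.exp M := by field_simp; ring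
  have e' : δ * M = f₀ a + δ * Real.log A := by rw [hM]; field_simp
  rw [e, Real.log_exp, e'] at h
  linarith [p₀ _ (ha.trans_le hy)]

/-- Iterating the improvement yields `k / (k + 1) f₁² ≤ f₀ f₂` for every `k`. -/
lemma natCast_mul_sq_le (k : ℕ) : ∀ f : ℕ → ℝ → ℝ,
    (∀ n x, 0 < x → HasDerivAt (f n) (-f (n + 1) x) x) → (∀ n x, 0 < x → 0 < f n x) →
    ∀ x, 0 < x → k * f 1 x ^ 2 ≤ (k + 1) * (f 0 x * f 2 x) := by
  induction k with
  | zero =>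
    intro f _ p x hx
    simpa using (mul_pos (p 0 x hx) (p 2 x hx)).le
  | succ k ih =>
    intro f h p x hx
    have hk : (0 : ℝ) < k + 1 := by positivity
    have e : (2 - (k : ℝ) / (k + 1)) = (k + 2) / (k + 1) := by field_simp; ring
    have key := sq_le_mul_of_mul_sq_le (d := k / (k + 1)) (h 0) (h 1) (h 2) (p 0) (p 1) (p 2)
      (fun y hy => by
        have := ih (fun n => f (n + 1)) (fun n => h (n + 1)) (fun n => p (n + 1)) y hy
        rw [div_mul_eq_mul_div, div_le_iff₀ hk]
        simp only [Nat.reduceAdd, zero_add] at this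
        linarith) (by rw [e]; positivity) hx
    rw [e, div_mul_eq_mul_div, le_div_iff₀ hk] at key
    push_cast
    linarith

/-- A positive function whose successive negated derivatives are all positive satisfies
`f₁² ≤ f₀ f₂`. -/
lemma sq_le_mul_of_pos (f : ℕ → ℝ → ℝ)
    (h : ∀ n x, 0 < x → HasDerivAt (f n) (-f (n + 1) x) x) (p : ∀ n x, 0 < x → 0 < f n x)
    {x : ℝ} (hx : 0 < x) : f 1 x ^ 2 ≤ f 0 x * f 2 x := by
  by_contra! hlt
  obtain ⟨k, hk⟩ := exists_nat_gt (f 0 x * f 2 x / (f 1 x ^ 2 - f 0 x * f 2 x))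
  rw [div_lt_iff₀ (sub_pos.2 hlt)] at hk
  linarith [natCast_mul_sq_le k f h p x hx]

/-- The bound `f₁² ≤ f₀ f₂` for nonnegative functions, by adding `ε exp (-x)` and letting
`ε → 0`. -/
lemma sq_le_mul_of_nonneg (f : ℕ → ℝ → ℝ)
    (h : ∀ n x, 0 < x → HasDerivAt (f n) (-f (n + 1) x) x) (p : ∀ n x, 0 < x → 0 ≤ f n x)
    {x : ℝ} (hx : 0 < x) : f 1 x ^ 2 ≤ f 0 x * f 2 x := by
  -- `exp (-x)` equals its own negated derivative, so adding it to every `f n` preserves the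
  -- relations and makes each term positive.
  have key : ∀ ε : ℝ, 0 < ε → (f 1 x + ε * Real.exp (-x)) ^ 2 ≤
      (f 0 x + ε * Real.exp (-x)) * (f 2 x + ε * Real.exp (-x)) := by
    intro ε hε
    refine sq_le_mul_of_pos (fun n y => f n y + ε * Real.exp (-y)) (fun n y hy => ?_)
      (fun n y hy => add_pos_of_nonneg_of_pos (p n y hy) (by positivity)) hx
    refine HasDerivAt.congr_deriv ((h n y hy).add ((hasDerivAt_neg y).exp.const_mul ε)) ?_
    ring
  have c : ∀ u v : ℝ, Tendsto (fun ε : ℝ => (u + ε * Real.exp (-x)) * (v + ε * Real.exp (-x)))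
      (𝓝[>] 0) (𝓝 (u * v)) := by
    intro u v
    refine tendsto_nhdsWithin_of_tendsto_nhds ?_
    have : Continuous fun ε : ℝ => (u + ε * Real.exp (-x)) * (v + ε * Real.exp (-x)) := by fun_prop
    simpa using this.tendsto 0
  rw [sq]
  refine le_of_tendsto_of_tendsto (c _ _) (c _ _) ?_
  filter_upwards [self_mem_nhdsWithin] with ε hε
  simpa only [sq] using key ε hε

theorem propositionp12 (φ : ℝ → ℝ) (hpos : ∀ x ∈ Set.Ici (0 : ℝ), 0 < φ x)
    (hφ : CompletelyMonotone φ) :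
    ConvexOn ℝ (Set.Ici 0) (fun x => Real.log (φ x)) := by
  obtain ⟨hs, hm⟩ := hφ
  set f : ℕ → ℝ → ℝ := fun n x => (-1 : ℝ) ^ n * iteratedDerivWithin n φ (Ici 0) x with hf
  have hder : ∀ n x, 0 < x → HasDerivAt (f n) (-f (n + 1) x) x := by
    intro n x hx
    have hd := hs.differentiableOn_iteratedDerivWithin (m := n) (by exact_mod_cast ENat.natCast_lt_top n)
      (uniqueDiffOn_Ici 0)
    have h1 := ((hd x hx.le).hasDerivWithinAt.hasDerivAt (Ici_mem_nhds hx)).const_mul ((-1 : ℝ) ^ n)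
    rw [← iteratedDerivWithin_succ] at h1
    refine HasDerivAt.congr_deriv (h1) ?_
    simp only [hf, pow_succ]
    ring
  have f0 : f 0 = φ := by ext x; simp [hf]
  have key : ∀ x, 0 < x → f 1 x ^ 2 ≤ φ x * f 2 x := fun x hx => by
    rw [← f0]; exact sq_le_mul_of_nonneg f hder (fun n y hy => hm n y hy.le) hx
  -- Derivatives are needed only in the interior; continuity covers the endpoint `0`.
  refine convexOn_of_hasDerivWithinAt2_nonneg (f' := fun x => -f 1 x / φ x)
    (f'' := fun x => (φ x * f 2 x - f 1 x ^ 2) / φ x ^ 2) (convex_Ici 0)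
    (hs.continuousOn.log fun x hx => (hpos x hx).ne') ?_ ?_ ?_
  all_goals
    intro x hx
    rw [interior_Ici] at hx
    have hx0 : 0 < x := hx
    have hne := (hpos x hx0.le).ne'
    have hφ' := hder 0 x hx0
    rw [f0, zero_add] at hφ'
  · exact (hφ'.log hne).hasDerivWithinAt
  · refine HasDerivAt.hasDerivWithinAt ?_
    refine HasDerivAt.congr_deriv ((hder 1 x hx0).neg.div hφ' hne) ?_
    simp only [Pi.neg_apply]
    ring
  · exact div_nonneg (sub_nonneg.2 (key x hx0)) (sq_nonneg _)
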